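/- For $z=u(1+i)+v(1-i)\in\mathbb{C}$ with $u,v\in\mathbb{R}$, put $$\lfloor z\rfloor_T=\lfloor u+\tfrac12\rfloor(1+i)+\lfloor v+\tfrac12\rfloor(1-i),$$ and let $X=\{u(1+i)+v(1-i) : -\tfrac12\le u,v<\tfrac12\}$. Define Tanaka's map $T_T:X\to X$ by $T_T(z)=\frac1z-\lfloor \frac1z\rfloor_T$ for $z\neq 0$ and $T_T(0)=0$. For $\alpha\in X$, Tanaka's algorithm produces $\alpha_{(1)}=\alpha$, $\alpha_{(k+1)}=T_T(\alpha_{(k)})$ with partial quotients $a_k=\lfloor 1/\alpha_{(k)}\rfloor_T$, and it terminates when $\alpha_{(k)}=0$. The resulting expansion $[0;a_1,a_2,\dots]$ of $\alpha$ is called purely periodic if the algorithm never terminates and there is an integer $p\ge 1$ such that $\alpha_{(k+p)}=\alpha_{(k)}$ (and hence $a_{k+p}=a_k$) for all $k\ge1$. **Theorem.** Let $m,n$ be integers, and let $\sqrt{m+ni}$ denote either of the square roots of $m+ni$ in $\mathbb{C}$. Suppose that $\sqrt{m+ni}\notin\mathbb{Q}(i)$, and let $\alpha=\sqrt{m+ni}-\lfloor\sqrt{m+ni}\rfloor_T$.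 Then the expansion of $\alpha$ given by Tanaka's algorithm is purely periodic. -/

import Mathlib

/-- The field `ℚ(i)`, as a subfield of `ℂ`. -/
noncomputable def GaussianField : IntermediateField ℚ ℂ :=
  IntermediateField.adjoin ℚ {Complex.I}

/-- The first coordinate `u` of `z = u(1+i) + v(1-i)`, with `u, v` real. -/
noncomputable def coordU (z : ℂ) : ℝ := (z.re + z.im) / 2

/-- The second coordinate `v` of `z = u(1+i) + v(1-i)`, with `u, v` real. -/
noncomputable def coordV (z : ℂ) : ℝ := (z.re - z.im) / 2

/-- `coordU z` and `coordV z` are the coordinates of `z` in the real basis `1+i, 1-i`. -/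
theorem eq_coord_iff (z : ℂ) (u v : ℝ) :
    z = u * (1 + Complex.I) + v * (1 - Complex.I) ↔ u = coordU z ∧ v = coordV z := by
  rw [Complex.ext_iff]
  simp only [coordU, coordV, Complex.add_re, Complex.add_im, Complex.mul_re, Complex.mul_im,
    Complex.sub_re, Complex.sub_im, Complex.ofReal_re, Complex.ofReal_im, Complex.one_re,
    Complex.one_im, Complex.I_re, Complex.I_im]
  constructor
  · rintro ⟨h1, h2⟩
    constructor <;> linarith
  · rintro ⟨h1, h2⟩
    constructor <;> linarith

/-- Tanaka's floor `⌊z⌋_T = ⌊u + 1/2⌋(1+i) + ⌊v + 1/2⌋(1-i)` for `z = u(1+i) + v(1-i)`. -/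
noncomputable def tanakaFloor (z : ℂ) : ℂ :=
  (⌊coordU z + 1 / 2⌋ : ℂ) * (1 + Complex.I) + (⌊coordV z + 1 / 2⌋ : ℂ) * (1 - Complex.I)

/-- The half-open square `X = {u(1+i) + v(1-i) | -1/2 ≤ u, v < 1/2}`. -/
def tanakaX : Set ℂ :=
  {z | -(1 / 2) ≤ coordU z ∧ coordU z < 1 / 2 ∧ -(1 / 2) ≤ coordV z ∧ coordV z < 1 / 2}

/-- Subtracting the floor lands in the square `X`. -/
theorem sub_tanakaFloor_mem (z : ℂ) : z - tanakaFloor z ∈ tanakaX := by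
  have hu := Int.floor_le (coordU z + 1 / 2)
  have hu' := Int.lt_floor_add_one (coordU z + 1 / 2)
  have hv := Int.floor_le (coordV z + 1 / 2)
  have hv' := Int.lt_floor_add_one (coordV z + 1 / 2)
  have h := (eq_coord_iff z _ _).2 ⟨rfl, rfl⟩
  have key := (eq_coord_iff (z - tanakaFloor z) (coordU z - ⌊coordU z + 1 / 2⌋)
    (coordV z - ⌊coordV z + 1 / 2⌋)).1 (by
      rw [tanakaFloor]
      push_cast
      linear_combination h)
  obtain ⟨h1, h2⟩ := key
  refine ⟨?_, ?_, ?_, ?_⟩ <;> linarith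

/-- The partial quotient map `a_T(z) = ⌊1/z⌋_T` for `z ≠ 0`, and `a_T(0) = 0`. -/
noncomputable def tanakaQuotient (z : ℂ) : ℂ :=
  open Classical in if z = 0 then 0 else tanakaFloor (1 / z)

/-- Tanaka's map `T_T(z) = 1/z - ⌊1/z⌋_T` for `z ≠ 0`, and `T_T(0) = 0`. -/
noncomputable def tanakaMap (z : ℂ) : ℂ :=
  open Classical in if z = 0 then 0 else 1 / z - tanakaFloor (1 / z)

/-- The orbit `α_(1) = α`, `α_(k+1) = T_T(α_(k))` of Tanaka's algorithm, indexed from `0`, so that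
`tanakaOrbit α k` is `α_(k+1)`. The algorithm terminates when the orbit reaches `0`. -/
noncomputable def tanakaOrbit (α : ℂ) (k : ℕ) : ℂ := tanakaMap^[k] α

/-- The expansion `[0; a₁, a₂, …]` produced by Tanaka's algorithm is purely periodic: the algorithm
never terminates, and for some `p ≥ 1` the orbit and the sequence of partial quotients
`a_T(α_(k))` are both periodic with period `p` from their first terms on. -/
def IsPurelyPeriodicTanaka (α : ℂ) : Prop :=
  (∀ k, tanakaOrbit α k ≠ 0) ∧
    ∃ p : ℕ, 1 ≤ p ∧ ∀ k,
      tanakaOrbit α (k + p) = tanakaOrbit α k ∧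
      tanakaQuotient (tanakaOrbit α (k + p)) = tanakaQuotient (tanakaOrbit α k)

open Complex

/-! Follow each orbit point `z` together with its conjugate `w` under `s ↦ -s`. `tanakaExtension`
subtracts the floor of `1/z` from both `1/z` and `1/w`. It is an injective self-map of the finite
set `reducedSet s`, hence a permutation, so all its orbits are purely periodic. The pair obtained
from `s` lies in this set when `|s| > 1`.

Invariance (`reduced_step`) is plane geometry of a domain bounded by lines and circles. For
finiteness, write `z, w = (P ± s)/Q`: `separation` bounds `|z - w|` below, hence `Q` and then `P`
above. For injectivity, two preimages with different partial quotients would force the image point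
onto a side of the square. Then its conjugate lies on the same line (`IsConjugatePair.on_line`),
whereas `NoCommonCircle`, an invariant inherited from the pair `s, -s`, forbids this.

If `|s| ≤ 1`, then `s² = ±i` and the orbit is computed explicitly. -/

/-! ### Gaussian integers and the Gaussian field -/

/-- The Gaussian integers as a subring of `ℂ`. -/
noncomputable def gaussianSubring : Subring ℂ := GaussianInt.toComplex.range

theorem mem_gaussianSubring_iff {z : ℂ} :
    z ∈ gaussianSubring ↔ ∃ a b : ℤ, z = (a : ℂ) + (b : ℂ) * I := by
  constructor
  · rintro ⟨x, rfl⟩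
    exact ⟨x.re, x.im, GaussianInt.toComplex_def x⟩
  · rintro ⟨a, b, rfl⟩
    exact ⟨⟨a, b⟩, GaussianInt.toComplex_def _⟩

theorem I_mem_gaussianField : I ∈ GaussianField :=
  IntermediateField.mem_adjoin_simple_self ℚ I

theorem gaussianSubring_le {z : ℂ} (hz : z ∈ gaussianSubring) : z ∈ GaussianField := by
  obtain ⟨a, b, rfl⟩ := mem_gaussianSubring_iff.1 hz
  exact add_mem (intCast_mem _ a) (mul_mem (intCast_mem _ b) I_mem_gaussianField)

theorem I_mem_gaussianSubring : I ∈ gaussianSubring :=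
  mem_gaussianSubring_iff.2 ⟨0, 1, by simp⟩

/-- Complex conjugation is used in `IsConjugatePair.on_line` to solve for a point of a line over
`ℚ(i)`. -/
theorem conj_mem_gaussianField {z : ℂ} (hz : z ∈ GaussianField) :
    (starRingEnd ℂ) z ∈ GaussianField := by
  unfold GaussianField at hz
  induction hz using IntermediateField.adjoin_induction with
  | mem x hx =>
    rw [Set.mem_singleton_iff] at hx
    subst hx
    rw [conj_I]
    exact neg_mem I_mem_gaussianField
  | algebraMap q =>
    have : (starRingEnd ℂ) (algebraMap ℚ ℂ q) = algebraMap ℚ ℂ q := by simp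
    rw [this]
    exact algebraMap_mem _ q
  | add x y _ _ hx hy => rw [map_add]; exact add_mem hx hy
  | inv x _ hx => rw [map_inv₀]; exact inv_mem hx
  | mul x y _ _ hx hy => rw [map_mul]; exact mul_mem hx hy

theorem one_le_norm_of_mem_gaussianSubring {z : ℂ} (hz : z ∈ gaussianSubring) (h0 : z ≠ 0) :
    1 ≤ ‖z‖ := by
  obtain ⟨a, b, rfl⟩ := mem_gaussianSubring_iff.1 hz
  have h1 : normSq ((a : ℂ) + (b : ℂ) * I) = ((a * a + b * b : ℤ) : ℝ) := by
    simp [normSq_apply]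
  have h2 : 0 < normSq ((a : ℂ) + (b : ℂ) * I) := normSq_pos.2 h0
  rw [h1] at h2
  have h3 : (1 : ℤ) ≤ a * a + b * b := by exact_mod_cast h2
  have h4 : (1 : ℝ) ≤ normSq ((a : ℂ) + (b : ℂ) * I) := by rw [h1]; exact_mod_cast h3
  rw [normSq_eq_norm_sq] at h4
  nlinarith [norm_nonneg ((a : ℂ) + (b : ℂ) * I)]

theorem finite_gaussianSubring_norm_le (M : ℝ) :
    {z : ℂ | z ∈ gaussianSubring ∧ ‖z‖ ≤ M}.Finite := by
  refine (((Set.finite_Icc (-⌈M⌉) ⌈M⌉).prod (Set.finite_Icc (-⌈M⌉) ⌈M⌉)).image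
    (fun x : ℤ × ℤ => (x.1 : ℂ) + (x.2 : ℂ) * I)).subset ?_
  rintro z ⟨hz, hM⟩
  obtain ⟨a, b, rfl⟩ := mem_gaussianSubring_iff.1 hz
  have ha := (abs_re_le_norm _).trans hM
  have hb := (abs_im_le_norm _).trans hM
  simp only [add_re, intCast_re, mul_re, I_re, mul_zero, intCast_im, I_im, mul_one, sub_self,
    add_zero, add_im, mul_im, zero_add] at ha hb
  have key : ∀ c : ℤ, |(c : ℝ)| ≤ M → c ∈ Set.Icc (-⌈M⌉) ⌈M⌉ := by
    intro c hc
    have h := abs_le.1 (hc.trans (Int.le_ceil M))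
    exact ⟨by exact_mod_cast h.1, by exact_mod_cast h.2⟩
  exact ⟨(a, b), ⟨key a ha, key b hb⟩, rfl⟩

/-! ### The floor in Cartesian coordinates -/

/-- Only the closed square is retained: orbit points on its sides are ruled out by `not_on_side`. -/
theorem tanakaFloor_spec (z : ℂ) : ∃ a b : ℤ, Even (a + b) ∧
    tanakaFloor z = (a : ℂ) + (b : ℂ) * I ∧ |z.re - a| + |z.im - b| ≤ 1 := by
  refine ⟨⌊coordU z + 1 / 2⌋ + ⌊coordV z + 1 / 2⌋, ⌊coordU z + 1 / 2⌋ - ⌊coordV z + 1 / 2⌋,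
    ⟨⌊coordU z + 1 / 2⌋, by ring⟩, ?_, ?_⟩
  · rw [tanakaFloor]
    push_cast
    ring
  · have hu := Int.floor_le (coordU z + 1 / 2)
    have hu' := Int.lt_floor_add_one (coordU z + 1 / 2)
    have hv := Int.floor_le (coordV z + 1 / 2)
    have hv' := Int.lt_floor_add_one (coordV z + 1 / 2)
    simp only [coordU, coordV] at *
    push_cast
    rcases abs_cases (z.re - (⌊(z.re + z.im) / 2 + 1 / 2⌋ + ⌊(z.re - z.im) / 2 + 1 / 2⌋ : ℝ))
      with h | h <;>
    rcases abs_cases (z.im - (⌊(z.re + z.im) / 2 + 1 / 2⌋ - ⌊(z.re - z.im) / 2 + 1 / 2⌋ : ℝ))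
      with h' | h' <;> linarith

/-- Floors lie in the ideal `(1+i)`, whose smallest norms are 0, 2 and 4. -/
theorem int_sq_add_sq_of_even {a b : ℤ} (h : Even (a + b)) :
    (a = 0 ∧ b = 0) ∨ ((a = 1 ∨ a = -1) ∧ (b = 1 ∨ b = -1)) ∨ 4 ≤ a ^ 2 + b ^ 2 := by
  by_cases ha : 2 ≤ |a|
  · right; right
    nlinarith [sq_abs a, sq_nonneg b]
  by_cases hb : 2 ≤ |b|
  · right; right
    nlinarith [sq_abs b, sq_nonneg a]
  obtain ⟨k, hk⟩ := h
  have h1 := abs_lt.1 (not_le.1 ha)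
  have h2 := abs_lt.1 (not_le.1 hb)
  omega

/-- The parallelogram law. It settles every translate in `reduced_step` except `0` and `±1 ± i`. -/
theorem one_lt_dist_sq {h k a b : ℝ} (hη : h ^ 2 + k ^ 2 < 1) (hab : 4 ≤ a ^ 2 + b ^ 2) :
    1 < (h - a) ^ 2 + (k - b) ^ 2 := by
  by_contra hc
  have e : a ^ 2 + b ^ 2 + ((2 * h - a) ^ 2 + (2 * k - b) ^ 2) =
    2 * (h ^ 2 + k ^ 2) + 2 * ((h - a) ^ 2 + (k - b) ^ 2) := by ring
  nlinarith [sq_nonneg (2 * h - a), sq_nonneg (2 * k - b)]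

/-! ### The domain of the natural extension -/

/-- The pairs `(z, w)` such that `z` is in the closed square, `w` is outside the unit disc, and
`w` is outside the unit disc about `e = ±1 ± i` if `z` is in the disc with diameter `[0, e]`. -/
def IsReducedPair (z w : ℂ) : Prop :=
  |z.re| + |z.im| ≤ 1 ∧ 1 < w.re ^ 2 + w.im ^ 2 ∧
    ∀ p q : ℝ, (p = 1 ∨ p = -1) → (q = 1 ∨ q = -1) →
      z.re ^ 2 + z.im ^ 2 < p * z.re + q * z.im → 1 < (w.re - p) ^ 2 + (w.im - q) ^ 2

theorem sign_mul_le {x y p q c : ℝ} (h : |x| + |y| ≤ c) (hp : p = 1 ∨ p = -1)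
    (hq : q = 1 ∨ q = -1) : p * x + q * y ≤ c := by
  have h1 := le_abs_self x
  have h2 := neg_abs_le x
  have h3 := le_abs_self y
  have h4 := neg_abs_le y
  rcases hp with rfl | rfl <;> rcases hq with rfl | rfl <;> linarith

theorem re_inv_mul {z : ℂ} (hz : z ≠ 0) :
    (1 / z).re * (z.re ^ 2 + z.im ^ 2) = z.re ∧ (1 / z).im * (z.re ^ 2 + z.im ^ 2) = -z.im := by
  have h : normSq z ≠ 0 := by simpa using hz
  have e : z.re ^ 2 + z.im ^ 2 = normSq z := by rw [normSq_apply]; ring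
  rw [e, one_div, inv_re, inv_im]
  constructor <;> field_simp

theorem sq_add_sq_pos {z : ℂ} (hz : z ≠ 0) : 0 < z.re ^ 2 + z.im ^ 2 := by
  have h := normSq_pos.2 hz
  rw [normSq_apply] at h
  nlinarith

theorem inv_sq_add_sq {z : ℂ} (hz : z ≠ 0) :
    ((1 / z).re ^ 2 + (1 / z).im ^ 2) * (z.re ^ 2 + z.im ^ 2) = 1 := by
  obtain ⟨h1, h2⟩ := re_inv_mul hz
  have h := sq_add_sq_pos hz
  have e : ((1 / z).re ^ 2 + (1 / z).im ^ 2) * (z.re ^ 2 + z.im ^ 2) * (z.re ^ 2 + z.im ^ 2)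
      = 1 * (z.re ^ 2 + z.im ^ 2) := by
    calc _ = ((1 / z).re * (z.re ^ 2 + z.im ^ 2)) ^ 2
        + ((1 / z).im * (z.re ^ 2 + z.im ^ 2)) ^ 2 := by ring
      _ = _ := by rw [h1, h2]; ring
  exact mul_right_cancel₀ h.ne' e

theorem IsReducedPair.ne_zero_right {z w : ℂ} (h : IsReducedPair z w) : w ≠ 0 := by
  rintro rfl
  have := h.2.1
  norm_num at this

/-- Reducedness of `(z, w)` in terms of the inverses. -/
theorem IsReducedPair.inv {z w : ℂ} (hz : z ≠ 0) (h : IsReducedPair z w) :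
    (|(1 / z).re| + |(1 / z).im| ≤ (1 / z).re ^ 2 + (1 / z).im ^ 2) ∧
    (1 / w).re ^ 2 + (1 / w).im ^ 2 < 1 ∧
    ∀ p q : ℝ, (p = 1 ∨ p = -1) → (q = 1 ∨ q = -1) → 1 < p * (1 / z).re + q * (1 / z).im →
      1 < ((1 / w).re - p) ^ 2 + ((1 / w).im - q) ^ 2 := by
  have hw := h.ne_zero_right
  obtain ⟨h1, h2, h3⟩ := h
  obtain ⟨z1, z2⟩ := re_inv_mul hz
  obtain ⟨w1, w2⟩ := re_inv_mul hw
  have zn := inv_sq_add_sq hz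
  have wn := inv_sq_add_sq hw
  have zp := sq_add_sq_pos hz
  have wp := sq_add_sq_pos hw
  generalize (1 / z).re = x at *
  generalize (1 / z).im = y at *
  generalize (1 / w).re = a at *
  generalize (1 / w).im = b at *
  generalize hn : z.re ^ 2 + z.im ^ 2 = n at *
  generalize hm : w.re ^ 2 + w.im ^ 2 = m at *
  refine ⟨?_, ?_, ?_⟩
  · rw [← z1, ← abs_neg z.im, ← z2, abs_mul, abs_mul, abs_of_pos zp] at h1
    nlinarith
  · nlinarith
  · intro p q hp hq hpq
    -- The unit circle about `e` is orthogonal to the unit circle about 0, so `w ↦ 1/w` carries it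
    -- to the unit circle about the conjugate of `e`; hence the sign of `q`.
    have hq' : -q = 1 ∨ -q = -1 := by rcases hq with rfl | rfl <;> simp
    have e0 : p * z.re + -q * z.im = n * (p * x + q * y) := by
      linear_combination -p * z1 - q * z2
    have h4 := h3 p (-q) hp hq' (by rw [e0]; nlinarith)
    have p2 : p ^ 2 = 1 := by rcases hp with rfl | rfl <;> norm_num
    have q2 : q ^ 2 = 1 := by rcases hq with rfl | rfl <;> norm_num
    have e1 : (w.re - p) ^ 2 + (w.im - -q) ^ 2 = m - 2 * p * (a * m) + 2 * q * (-(b * m)) + 2 := by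
      rw [← hm] at *
      rw [w1, w2]
      linear_combination p2 + q2
    have e2 : ((a - p) ^ 2 + (b - q) ^ 2) * m =
        1 - 2 * p * (a * m) - 2 * q * (b * m) + 2 * m := by
      linear_combination wn + m * p2 + m * q2
    rw [e1] at h4
    by_contra hc
    nlinarith [mul_le_mul_of_nonneg_right (not_lt.1 hc) wp.le]

/-- A point of both the closed square and its image under inversion is a unit. -/
theorem unit_of_abs_add_abs {x y : ℝ} (h1 : |x| + |y| ≤ 1) (h2 : |x| + |y| ≤ x ^ 2 + y ^ 2) :
    x = 0 ∨ y = 0 := by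
  have hx := abs_nonneg x
  have hy := abs_nonneg y
  have h3 : |x| * |y| ≤ 0 := by
    nlinarith [sq_abs x, sq_abs y, mul_nonneg hx hy]
  have h4 : |x| * |y| = 0 := le_antisymm h3 (mul_nonneg hx hy)
  rcases mul_eq_zero.1 h4 with h | h
  · exact Or.inl (abs_eq_zero.1 h)
  · exact Or.inr (abs_eq_zero.1 h)

/-- One step of the natural extension in coordinates: `(x, y)` and `(h, k)` are the inverses of
the two components and `(a, b)` is the partial quotient. -/
theorem reduced_step {x y h k : ℝ} {a b : ℤ}
    (hirr : ∀ c d : ℤ, ¬ (x = c ∧ y = d))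
    (h1 : |x| + |y| ≤ x ^ 2 + y ^ 2) (h2 : h ^ 2 + k ^ 2 < 1)
    (h3 : ∀ p q : ℝ, (p = 1 ∨ p = -1) → (q = 1 ∨ q = -1) → 1 < p * x + q * y →
      1 < (h - p) ^ 2 + (k - q) ^ 2)
    (hev : Even (a + b)) (hab : |x - a| + |y - b| ≤ 1) :
    1 < (h - a) ^ 2 + (k - b) ^ 2 ∧
    ∀ p q : ℝ, (p = 1 ∨ p = -1) → (q = 1 ∨ q = -1) →
      (x - a) ^ 2 + (y - b) ^ 2 < p * (x - a) + q * (y - b) →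
      1 < (h - a - p) ^ 2 + (k - b - q) ^ 2 := by
  -- With quotient 0, the point `x + yi` is in the square and outside the four discs, which leaves
  -- only 0 and the units.
  have hne : ¬ (a = 0 ∧ b = 0) := by
    rintro ⟨rfl, rfl⟩
    simp only [Int.cast_zero, sub_zero] at hab
    rcases unit_of_abs_add_abs hab h1 with rfl | rfl
    · rw [abs_zero, zero_add] at h1 hab
      have : |y| = 0 ∨ |y| = 1 := by
        by_cases h0 : |y| = 0
        · exact Or.inl h0
        · have : 0 < |y| := lt_of_le_of_ne (abs_nonneg y) (Ne.symm h0)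
          exact Or.inr (by nlinarith [sq_abs y])
      rcases this with h0 | h0
      · exact hirr 0 0 ⟨by simp, by simpa using h0⟩
      · rcases eq_or_eq_neg_of_abs_eq h0 with h0 | h0
        · exact hirr 0 1 ⟨by simp, by simpa using h0⟩
        · exact hirr 0 (-1) ⟨by simp, by simpa using h0⟩
    · rw [abs_zero, add_zero] at h1 hab
      have : |x| = 0 ∨ |x| = 1 := by
        by_cases h0 : |x| = 0
        · exact Or.inl h0
        · have : 0 < |x| := lt_of_le_of_ne (abs_nonneg x) (Ne.symm h0)
          exact Or.inr (by nlinarith [sq_abs x])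
      rcases this with h0 | h0
      · exact hirr 0 0 ⟨by simpa using h0, by simp⟩
      · rcases eq_or_eq_neg_of_abs_eq h0 with h0 | h0
        · exact hirr 1 0 ⟨by simpa using h0, by simp⟩
        · exact hirr (-1) 0 ⟨by simpa using h0, by simp⟩
  have hsgn := fun p q hp hq => sign_mul_le (p := p) (q := q) hab hp hq
  have hin := fun p q hp hq => sign_mul_le (p := p) (q := q) h1 hp hq
  constructor
  · rcases int_sq_add_sq_of_even hev with h0 | ⟨ha, hb⟩ | h4
    · exact absurd h0 hne
    · have ha' : (a : ℝ) = 1 ∨ (a : ℝ) = -1 := by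
        rcases ha with rfl | rfl <;> simp
      have hb' : (b : ℝ) = 1 ∨ (b : ℝ) = -1 := by
        rcases hb with rfl | rfl <;> simp
      apply h3 a b ha' hb'
      have s1 := hsgn (-a) (-b) (by rcases ha' with h | h <;> simp [h])
        (by rcases hb' with h | h <;> simp [h])
      have s2 := hsgn a (-b) ha' (by rcases hb' with h | h <;> simp [h])
      have s3 := hsgn (-a) b (by rcases ha' with h | h <;> simp [h]) hb'
      have a2 : (a : ℝ) ^ 2 = 1 := by rcases ha' with h | h <;> rw [h] <;> norm_num
      have b2 : (b : ℝ) ^ 2 = 1 := by rcases hb' with h | h <;> rw [h] <;> norm_num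
      -- Otherwise `x + yi` lies on a side of the square, where `h1` leaves only the endpoints,
      -- which are Gaussian integers.
      by_contra hc
      have e1 : (a : ℝ) * x + b * y = 1 := by nlinarith
      have e2 : (a * x) ^ 2 + (b * y) ^ 2 = x ^ 2 + y ^ 2 := by
        rw [mul_pow, mul_pow, a2, b2]; ring
      have i1 := hin a b ha' hb'
      have n1 : 0 ≤ (a : ℝ) * x := by nlinarith
      have n2 : 0 ≤ (b : ℝ) * y := by nlinarith
      have e3 : ((a : ℝ) * x) * (b * y) = 0 := by
        apply le_antisymm _ (mul_nonneg n1 n2)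
        nlinarith
      rcases mul_eq_zero.1 e3 with e4 | e4
      · refine hirr 0 b ⟨?_, ?_⟩
        · push_cast; linear_combination a * e4 - x * a2
        · linear_combination b * (e1 - e4) - y * b2
      · refine hirr a 0 ⟨?_, ?_⟩
        · linear_combination a * (e1 - e4) - x * a2
        · push_cast; linear_combination b * e4 - y * b2
    · exact one_lt_dist_sq h2 (by exact_mod_cast h4)
  · intro p q hp hq hpq
    obtain ⟨p', hp', rfl⟩ : ∃ p' : ℤ, (p' = 1 ∨ p' = -1) ∧ p = p' := by
      rcases hp with rfl | rfl
      · exact ⟨1, by simp, by simp⟩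
      · exact ⟨-1, by simp, by simp⟩
    obtain ⟨q', hq', rfl⟩ : ∃ q' : ℤ, (q' = 1 ∨ q' = -1) ∧ q = q' := by
      rcases hq with rfl | rfl
      · exact ⟨1, by simp, by simp⟩
      · exact ⟨-1, by simp, by simp⟩
    have hev' : Even ((a + p') + (b + q')) := by
      obtain ⟨r, hr⟩ := hev
      rcases hp' with rfl | rfl <;> rcases hq' with rfl | rfl
      · exact ⟨r + 1, by omega⟩
      · exact ⟨r, by omega⟩
      · exact ⟨r, by omega⟩
      · exact ⟨r - 1, by omega⟩
    have p2 : (p' : ℝ) ^ 2 = 1 := by rcases hp with h | h <;> rw [h] <;> norm_num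
    have q2 : (q' : ℝ) ^ 2 = 1 := by rcases hq with h | h <;> rw [h] <;> norm_num
    rw [sub_sub, sub_sub]
    rcases int_sq_add_sq_of_even hev' with ⟨ha, hb⟩ | ⟨ha, hb⟩ | h4
    -- Here `x + yi` would lie inside the disc with diameter `[0, -e]`, where `e = p' + q'i`,
    -- against `h1`.
    · exfalso
      have ha' : (a : ℝ) = -p' := by exact_mod_cast eq_neg_of_add_eq_zero_left ha
      have hb' : (b : ℝ) = -q' := by exact_mod_cast eq_neg_of_add_eq_zero_left hb
      have i1 := hin (-p') (-q') (by rcases hp with h | h <;> simp [h])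
        (by rcases hq with h | h <;> simp [h])
      rw [ha', hb'] at hpq
      nlinarith
    · have ha' : (a : ℝ) + p' = 1 ∨ (a : ℝ) + p' = -1 := by
        rcases ha with h | h
        · left; exact_mod_cast h
        · right; exact_mod_cast h
      have hb' : (b : ℝ) + q' = 1 ∨ (b : ℝ) + q' = -1 := by
        rcases hb with h | h
        · left; exact_mod_cast h
        · right; exact_mod_cast h
      apply h3 _ _ ha' hb'
      set X := x - a with hX
      set Y := y - b with hY
      have hx : x = X + a := by rw [hX]; ring
      have hy : y = Y + b := by rw [hY]; ring
      -- As `a + bi ≠ 0`, the corner `a + bi + e` is either orthogonal to `e`, where `k1` places `x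
      -- + yi` beyond the side, or equal to `-e`, where `s1` does.
      have k1 : (p' * X - q' * Y) ^ 2 < 1 := by
        have : (p' * X - q' * Y) ^ 2 + (p' * X + q' * Y) ^ 2 = 2 * (X ^ 2 + Y ^ 2) := by
          linear_combination 2 * X ^ 2 * p2 + 2 * Y ^ 2 * q2
        nlinarith [sq_nonneg (p' * X + q' * Y - 1)]
      obtain ⟨k2, k3⟩ := abs_lt.1 ((sq_lt_one_iff_abs_lt_one _).1 k1)
      have s1 := hsgn p' q' hp hq
      have hne' : ¬ ((a : ℝ) = 0 ∧ (b : ℝ) = 0) := by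
        simpa using hne
      rw [hx, hy]
      generalize (a : ℝ) = a at *
      generalize (b : ℝ) = b at *
      generalize (p' : ℝ) = p at *
      generalize (q' : ℝ) = q at *
      rcases ha' with ha' | ha' <;> rcases hb' with hb' | hb' <;>
      · have ea := eq_sub_of_add_eq ha'
        have eb := eq_sub_of_add_eq hb'
        rw [ha', hb', ea, eb]
        rw [ea, eb] at hne'
        rcases hp with rfl | rfl <;> rcases hq with rfl | rfl <;>
        first
          | (exfalso; apply hne'; norm_num; done)
          | linarith
    · have := one_lt_dist_sq (h := h) (k := k) (a := (a : ℝ) + p') (b := (b : ℝ) + q') h2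
        (by exact_mod_cast h4)
      exact this

/-! ### Common circles -/

/-- No generalized circle `A|z|² + B Re z + B' Im z + C = 0` with integral coefficients,
discriminant `B² + B'² - 4AC = 2` and `A + C` odd passes through both `z` and `w`. These circles
include the sides of the square. -/
def NoCommonCircle (z w : ℂ) : Prop :=
  ∀ A B B' C : ℤ, B ^ 2 + B' ^ 2 - 4 * A * C = 2 → Odd (A + C) →
    ¬ (A * (z.re ^ 2 + z.im ^ 2) + B * z.re + B' * z.im + C = 0 ∧
      A * (w.re ^ 2 + w.im ^ 2) + B * w.re + B' * w.im + C = 0)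

/-- This is the change of `C` under translation. Discriminant 2 makes `B` and `B'` odd, so it is
congruent to `(A + 1)(a + b)` modulo 2. -/
theorem even_translate {A B B' C a b : ℤ} (h : B ^ 2 + B' ^ 2 - 4 * A * C = 2)
    (hab : Even (a + b)) : Even (A * (a ^ 2 + b ^ 2) - B * a - B' * b) := by
  have hB : Even (B ^ 2 + B' ^ 2) := ⟨1 + 2 * A * C, by linarith⟩
  have hB' : Odd B ∧ Odd B' := by
    rcases Int.even_or_odd B with ⟨u, hu⟩ | hu <;> rcases Int.even_or_odd B' with ⟨v, hv⟩ | hv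
    · exfalso
      subst hu hv
      have : 2 * (u ^ 2 + v ^ 2 - A * C) = 1 := by linarith
      omega
    · exfalso
      have := hv.pow (n := 2)
      rw [Int.even_add] at hB
      rw [← Int.not_even_iff_odd] at this
      exact this (hB.1 ⟨u * (u + u), by rw [hu]; ring⟩)
    · exfalso
      have := hu.pow (n := 2)
      rw [Int.even_add] at hB
      rw [← Int.not_even_iff_odd] at this
      exact this (hB.2 ⟨v * (v + v), by rw [hv]; ring⟩)
    · exact ⟨hu, hv⟩
  obtain ⟨⟨u, hu⟩, ⟨v, hv⟩⟩ := hB'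
  obtain ⟨t, ht⟩ := hab
  have hb : b = t + t - a := by linarith
  subst hu hv hb
  exact ⟨A * (a ^ 2 - 2 * t * a + 2 * t ^ 2) - u * a - v * (2 * t - a) - t, by ring⟩

theorem NoCommonCircle.translate {z w : ℂ} (h : NoCommonCircle z w) {a b : ℤ}
    (hab : Even (a + b)) :
    NoCommonCircle (z - ((a : ℂ) + (b : ℂ) * I)) (w - ((a : ℂ) + (b : ℂ) * I)) := by
  rintro A B B' C hD hO ⟨hz, hw⟩
  refine h A (B - 2 * A * a) (B' - 2 * A * b) (C + (A * (a ^ 2 + b ^ 2) - B * a - B' * b))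
    (by linear_combination hD) ?_ ⟨?_, ?_⟩
  · rw [← add_assoc]
    exact hO.add_even (even_translate hD hab)
  all_goals
    simp only [sub_re, add_re, intCast_re, mul_re, I_re, mul_zero, intCast_im, I_im, mul_one,
      sub_self, add_zero, sub_im, add_im, mul_im, zero_add] at hz hw
    push_cast
    first | linear_combination hz | linear_combination hw

/-- Inversion swaps `A` and `C` and negates `B'`, so the discriminant and `A + C` persist. -/
theorem NoCommonCircle.inv {z w : ℂ} (h : NoCommonCircle z w) (hz : z ≠ 0) (hw : w ≠ 0) :
    NoCommonCircle (1 / z) (1 / w) := by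
  have key : ∀ {u : ℂ}, u ≠ 0 → ∀ A B B' C : ℤ,
      A * ((1 / u).re ^ 2 + (1 / u).im ^ 2) + B * (1 / u).re + B' * (1 / u).im + C = 0 →
      C * (u.re ^ 2 + u.im ^ 2) + B * u.re + ((-B' : ℤ) : ℝ) * u.im + A = 0 := by
    intro u hu A B B' C he
    obtain ⟨h1, h2⟩ := re_inv_mul hu
    have h3 := inv_sq_add_sq hu
    push_cast
    linear_combination (u.re ^ 2 + u.im ^ 2) * he - A * h3 - B * h1 - B' * h2
  rintro A B B' C hD hO ⟨h1, h2⟩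
  exact h C B (-B') A (by linear_combination hD) (by rwa [add_comm])
    ⟨key hz _ _ _ _ h1, key hw _ _ _ _ h2⟩

/-- Adding the two equations gives `C = -A|s|²`, so the discriminant is at least 4 unless `A = C =
0`, which parity excludes. -/
theorem noCommonCircle_neg {s : ℂ} (hs : 1 ≤ s.re ^ 2 + s.im ^ 2) : NoCommonCircle s (-s) := by
  rintro A B B' C hD hO ⟨h1, h2⟩
  simp only [neg_re, neg_im] at h2
  have h3 : (A : ℝ) * (s.re ^ 2 + s.im ^ 2) = -C := by linarith
  have hDr : (B : ℝ) ^ 2 + B' ^ 2 - 4 * A * C = 2 := by exact_mod_cast hD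
  have hA : A ≠ 0 := by
    rintro rfl
    have hC : C = 0 := by
      have : (C : ℝ) = 0 := by simpa using h3.symm
      exact_mod_cast this
    subst hC
    simp at hO
  have hA1 : (1 : ℝ) ≤ (A : ℝ) ^ 2 := by
    have : 1 ≤ A ^ 2 := by have := sq_pos_of_ne_zero hA; omega
    exact_mod_cast this
  have h4 : (A : ℝ) * C = -(A ^ 2 * (s.re ^ 2 + s.im ^ 2)) := by
    linear_combination (A : ℝ) * h3
  nlinarith [sq_nonneg (B : ℝ), sq_nonneg (B' : ℝ), mul_le_mul hA1 hs zero_le_one (by positivity)]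

/-! ### Conjugate pairs -/

/-- `z = (P + s) / Q` and `w = (P - s) / Q` with Gaussian integers `P`, `Q` such that `Q` divides
`s² - P²`. -/
def IsConjugatePair (s z w : ℂ) : Prop :=
  ∃ P Q R : ℂ, P ∈ gaussianSubring ∧ Q ∈ gaussianSubring ∧ R ∈ gaussianSubring ∧
    Q * R = s ^ 2 - P ^ 2 ∧ z * Q = P + s ∧ w * Q = P - s

section ConjugatePair

variable {s z w : ℂ}

theorem add_ne_zero_of_notMem (hirr : s ∉ GaussianField) {P : ℂ} (hP : P ∈ gaussianSubring) :
    P + s ≠ 0 ∧ P - s ≠ 0 := by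
  constructor <;> intro h <;> apply hirr
  · rw [eq_neg_of_add_eq_zero_right h]
    exact neg_mem (gaussianSubring_le hP)
  · rw [← sub_eq_zero.1 h]
    exact gaussianSubring_le hP

theorem IsConjugatePair.notMem (hirr : s ∉ GaussianField) (h : IsConjugatePair s z w) :
    z ∉ GaussianField := by
  obtain ⟨P, Q, R, hP, hQ, -, -, hz, -⟩ := h
  intro hzK
  apply hirr
  rw [show s = z * Q - P by rw [hz]; ring]
  exact sub_mem (mul_mem hzK (gaussianSubring_le hQ)) (gaussianSubring_le hP)

theorem IsConjugatePair.symm (h : IsConjugatePair s z w) : IsConjugatePair s w z := by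
  obtain ⟨P, Q, R, hP, hQ, hR, hD, hz, hw⟩ := h
  exact ⟨-P, -Q, -R, neg_mem hP, neg_mem hQ, neg_mem hR, by rw [neg_mul_neg, hD]; ring,
    by rw [mul_neg, hw]; ring, by rw [mul_neg, hz]; ring⟩

theorem IsConjugatePair.ne_zero (hirr : s ∉ GaussianField) (h : IsConjugatePair s z w) :
    z ≠ 0 := by
  rintro rfl
  exact h.notMem hirr (zero_mem _)

/-- Since `1/z = (s - P)/R`, the cofactor `R` becomes the new denominator. -/
theorem IsConjugatePair.sub_mem (hirr : s ∉ GaussianField) (h : IsConjugatePair s z w) {a : ℂ}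
    (ha : a ∈ gaussianSubring) : IsConjugatePair s (1 / z - a) (1 / w - a) := by
  have hz0 := h.ne_zero hirr
  have hw0 := h.symm.ne_zero hirr
  obtain ⟨P, Q, R, hP, hQ, hR, hD, hz, hw⟩ := h
  obtain ⟨h1, h2⟩ := add_ne_zero_of_notMem hirr hP
  have hQ0 : Q ≠ 0 := by
    rintro rfl
    exact h1 (by rw [← hz, mul_zero])
  have e1 : R = z * (s - P) := by
    apply mul_left_cancel₀ hQ0
    linear_combination hD + (P - s) * hz
  have e2 : R = w * (-s - P) := by
    apply mul_left_cancel₀ hQ0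
    linear_combination hD + (P + s) * hw
  have h2' : (2 : ℂ) ∈ gaussianSubring := ofNat_mem _ 2
  refine ⟨-P - a * R, R, Q - 2 * a * P - a ^ 2 * R, _root_.sub_mem (neg_mem hP) (mul_mem ha hR),
    hR, _root_.sub_mem (_root_.sub_mem hQ (mul_mem (mul_mem h2' ha) hP))
      (mul_mem (pow_mem ha 2) hR), ?_, ?_, ?_⟩
  · linear_combination hD
  · rw [sub_mul]
    nth_rewrite 1 [e1]
    field_simp
    ring
  · rw [sub_mul]
    nth_rewrite 1 [e2]
    field_simp
    ring

/-- If `z` lies on the real line through a side of the square, then so does its conjugate `w`. -/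
theorem IsConjugatePair.on_line (hirr : s ∉ GaussianField) (h : IsConjugatePair s z w)
    {p q : ℤ} (hpq : p ≠ 0) (hz1 : p * z.re + q * z.im = 1) : p * w.re + q * w.im = 1 := by
  have hzK := h.notMem hirr
  obtain ⟨P, Q, R, hP, hQ, hR, hD, hz, hw⟩ := h
  obtain ⟨h1, h2⟩ := add_ne_zero_of_notMem hirr hP
  have hQ0 : Q ≠ 0 := by
    rintro rfl
    exact h1 (by rw [← hz, mul_zero])
  have hPK := gaussianSubring_le hP
  have hQK := gaussianSubring_le hQ
  have hRK := gaussianSubring_le hR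
  set f : ℂ := (p : ℂ) - (q : ℂ) * I with hf
  have hfK : f ∈ GaussianField :=
    _root_.sub_mem (intCast_mem _ p) (mul_mem (intCast_mem _ q) I_mem_gaussianField)
  have hf0 : f ≠ 0 := by
    intro h0
    have := congrArg re h0
    simp [hf] at this
    exact hpq this
  set x : ℂ := z * f - 1 with hx
  set y : ℂ := w * f - 1 with hy
  have hxre : x.re = 0 := by
    simp [hx, hf]
    linarith
  have hzw : z + w = 2 * P / Q := by
    field_simp
    linear_combination hz + hw
  have hzw' : z * w = -R / Q := by
    field_simp
    apply mul_left_cancel₀ hQ0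
    linear_combination w * Q * hz + (P + s) * hw + hD
  have h2K : (2 : ℂ) ∈ GaussianField := ofNat_mem _ 2
  have hS : x + y ∈ GaussianField := by
    rw [show x + y = (z + w) * f - 2 by rw [hx, hy]; ring, hzw]
    exact _root_.sub_mem (mul_mem (div_mem (mul_mem h2K hPK) hQK) hfK) h2K
  have hN : x * y ∈ GaussianField := by
    rw [show x * y = (z * w) * f ^ 2 - (z + w) * f + 1 by rw [hx, hy]; ring, hzw, hzw']
    exact add_mem (_root_.sub_mem (mul_mem (div_mem (neg_mem hRK) hQK) (pow_mem hfK 2))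
      (mul_mem (div_mem (mul_mem h2K hPK) hQK) hfK)) (one_mem _)
  have hxc : (starRingEnd ℂ) x = -x := by
    apply Complex.ext <;> simp [hxre]
  -- As `x` is purely imaginary, `xy` minus its conjugate equals `x` times the trace `y + ȳ`, which
  -- is also that of `x + y`. A nonzero trace would put `x` in `ℚ(i)`.
  have hyre : y.re = 0 := by
    by_contra hne
    have hS0 : (x + y) + (starRingEnd ℂ) (x + y) ≠ 0 := by
      intro h0
      have := congrArg re h0
      simp [hxre] at this
      exact hne this
    have e : x = (x * y - (starRingEnd ℂ) (x * y)) / ((x + y) + (starRingEnd ℂ) (x + y)) := by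
      rw [eq_div_iff hS0, map_mul, map_add, hxc]
      ring
    have hxK : x ∈ GaussianField := by
      rw [e]
      exact div_mem (_root_.sub_mem hN (conj_mem_gaussianField hN))
        (add_mem hS (conj_mem_gaussianField hS))
    apply hzK
    rw [show z = (x + 1) / f by rw [hx]; field_simp; ring]
    exact div_mem (add_mem hxK (one_mem _)) hfK
  simp [hy, hf] at hyre
  linarith

end ConjugatePair

/-! ### Finiteness of the reduced set -/

/-- Each point of the square is close to a corner, relative to its distance to the unit circle. -/
theorem exists_corner {z : ℂ} (hz : |z.re| + |z.im| ≤ 1) :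
    ∃ c : ℂ, c ∈ gaussianSubring ∧ ‖z - c‖ ≤ 4 * (1 - ‖z‖) := by
  -- `d` is the distance to the corner `c` along its axis; the other coordinate is at most `d` in
  -- absolute value.
  have key : ∀ c : ℂ, ∀ d : ℝ, 0 ≤ d → d ≤ 1 → ‖z - c‖ ^ 2 ≤ 2 * d ^ 2 → ‖z‖ ^ 2 ≤ 1 - d →
      ‖z - c‖ ≤ 4 * (1 - ‖z‖) := by
    intro c d h0 h1 h2 h3
    have h4 : ‖z‖ ≤ 1 - d / 2 := abs_le_of_sq_le_sq' (by nlinarith) (by linarith) |>.2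
    have h5 : ‖z - c‖ ≤ 2 * d := abs_le_of_sq_le_sq' (by nlinarith) (by linarith) |>.2
    linarith
  have hx := abs_nonneg z.re
  have hy := abs_nonneg z.im
  have hI := I_mem_gaussianSubring
  rcases le_total |z.im| |z.re| with hle | hle
  · rcases le_total 0 z.re with hs | hs
    · rw [abs_of_nonneg hs] at *
      refine ⟨1, one_mem _, key 1 (1 - z.re) ?_ ?_ ?_ ?_⟩
      · linarith
      · linarith
      · rw [← normSq_eq_norm_sq, normSq_apply]
        simp only [sub_re, one_re, sub_im, one_im, sub_zero]
        nlinarith [sq_abs z.im]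
      · rw [← normSq_eq_norm_sq, normSq_apply]
        nlinarith [sq_abs z.im]
    · rw [abs_of_nonpos hs] at *
      refine ⟨-1, neg_mem (one_mem _), key (-1) (1 + z.re) ?_ ?_ ?_ ?_⟩
      · linarith
      · linarith
      · rw [← normSq_eq_norm_sq, normSq_apply]
        simp only [sub_re, one_re, sub_im, one_im, neg_re, neg_im, neg_zero, sub_zero]
        nlinarith [sq_abs z.im]
      · rw [← normSq_eq_norm_sq, normSq_apply]
        nlinarith [sq_abs z.im]
  · rcases le_total 0 z.im with hs | hs
    · rw [abs_of_nonneg hs] at *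
      refine ⟨I, hI, key I (1 - z.im) ?_ ?_ ?_ ?_⟩
      · linarith
      · linarith
      · rw [← normSq_eq_norm_sq, normSq_apply]
        simp only [sub_re, I_re, sub_im, I_im, sub_zero]
        nlinarith [sq_abs z.re]
      · rw [← normSq_eq_norm_sq, normSq_apply]
        nlinarith [sq_abs z.re]
    · rw [abs_of_nonpos hs] at *
      refine ⟨-I, neg_mem hI, key (-I) (1 + z.im) ?_ ?_ ?_ ?_⟩
      · linarith
      · linarith
      · rw [← normSq_eq_norm_sq, normSq_apply]
        simp only [sub_re, I_re, sub_im, I_im, neg_re, neg_im, neg_zero, sub_zero]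
        nlinarith [sq_abs z.re]
      · rw [← normSq_eq_norm_sq, normSq_apply]
        nlinarith [sq_abs z.re]

/-- The components of a reduced conjugate pair are uniformly separated. -/
theorem separation {s z w : ℂ} (hirr : s ∉ GaussianField) (hc : IsConjugatePair s z w)
    (hr : IsReducedPair z w) : 1 ≤ 40 * ‖s‖ * ‖z - w‖ := by
  have hzK := hc.notMem hirr
  obtain ⟨P, Q, R, hP, hQ, hR, hD, hz, hw⟩ := hc
  obtain ⟨h1, h2⟩ := add_ne_zero_of_notMem hirr hP
  have hQ0 : Q ≠ 0 := by
    rintro rfl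
    exact h1 (by rw [← hz, mul_zero])
  obtain ⟨c, hcG, hcz⟩ := exists_corner hr.1
  have hw1 : 1 ≤ ‖w‖ := by
    have h := hr.2.1
    have e : w.re ^ 2 + w.im ^ 2 = ‖w‖ ^ 2 := by
      rw [← normSq_eq_norm_sq, normSq_apply]; ring
    rw [e] at h
    nlinarith [norm_nonneg w]
  have hzc : 0 < ‖z - c‖ := by
    rw [norm_pos_iff, sub_ne_zero]
    rintro rfl
    exact hzK (gaussianSubring_le hcG)
  have h2G : (2 : ℂ) ∈ gaussianSubring := ofNat_mem _ 2
  -- The value at `c` of the quadratic `QX² - 2PX - R`, whose roots are `z` and `w`.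
  set N : ℂ := c ^ 2 * Q - R - 2 * c * P with hN
  have hNG : N ∈ gaussianSubring :=
    sub_mem (sub_mem (mul_mem (pow_mem hcG 2) hQ) hR) (mul_mem (mul_mem h2G hcG) hP)
  have hprod : (z - c) * (w - c) * Q = N := by
    apply mul_left_cancel₀ hQ0
    rw [hN]
    linear_combination (w * Q - c * Q) * hz + (P + s - c * Q) * hw + hD
  have hN0 : N ≠ 0 := by
    intro h0
    have e : (P - c * Q + s) * (P - c * Q - s) = 0 := by
      linear_combination Q * h0 - Q * hN + hD
    have hPG : P - c * Q ∈ gaussianSubring := sub_mem hP (mul_mem hcG hQ)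
    obtain ⟨h3, h4⟩ := add_ne_zero_of_notMem hirr hPG
    exact mul_ne_zero h3 h4 e
  have hN1 := one_le_norm_of_mem_gaussianSubring hNG hN0
  have hdiff : ‖z - w‖ * ‖Q‖ = 2 * ‖s‖ := by
    rw [← norm_mul, show (z - w) * Q = 2 * s by linear_combination hz - hw, norm_mul]
    simp
  have hbound : ‖z - w‖ ≤ 2 * ‖s‖ * (‖z - c‖ * ‖w - c‖) := by
    have : ‖z - c‖ * ‖w - c‖ * ‖Q‖ = ‖N‖ := by rw [← hprod, norm_mul, norm_mul]
    calc ‖z - w‖ ≤ ‖z - w‖ * ‖N‖ := le_mul_of_one_le_right (norm_nonneg _) hN1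
      _ = (‖z - w‖ * ‖Q‖) * (‖z - c‖ * ‖w - c‖) := by rw [← this]; ring
      _ = _ := by rw [hdiff]
  have hsep : ‖z - c‖ ≤ 4 * ‖z - w‖ := by
    have := norm_sub_norm_le w z
    rw [norm_sub_rev] at this
    linarith
  have hwc : ‖w - c‖ ≤ 5 * ‖z - w‖ := by
    have h5 : ‖w - c‖ ≤ ‖w - z‖ + ‖z - c‖ := by
      simpa using norm_sub_le_norm_sub_add_norm_sub w z c
    rw [norm_sub_rev w z] at h5
    linarith
  -- `hsep` and `hbound` give `8 = 4 · 2`; after cancelling `‖z - c‖`, `hwc` gives `40 = 8 · 5`.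
  have h6 : ‖z - c‖ * 1 ≤ ‖z - c‖ * (8 * ‖s‖ * ‖w - c‖) := by nlinarith
  have h7 := le_of_mul_le_mul_left h6 hzc
  nlinarith [norm_nonneg s]

/-- The invariant set of pairs of an orbit point and its conjugate. -/
def reducedSet (s : ℂ) : Set (ℂ × ℂ) :=
  {x | IsReducedPair x.1 x.2 ∧ NoCommonCircle x.1 x.2 ∧ IsConjugatePair s x.1 x.2}

theorem finite_reducedSet {s : ℂ} (hirr : s ∉ GaussianField) : (reducedSet s).Finite := by
  set M : ℝ := 80 * ‖s‖ ^ 2 with hM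
  refine (((finite_gaussianSubring_norm_le (M + ‖s‖)).prod
    (finite_gaussianSubring_norm_le M)).image
    (fun x : ℂ × ℂ => ((x.1 + s) / x.2, (x.1 - s) / x.2))).subset ?_
  rintro ⟨z, w⟩ ⟨hr, -, hc⟩
  have hsep := separation hirr hc hr
  obtain ⟨P, Q, R, hP, hQ, hR, hD, hz, hw⟩ := hc
  obtain ⟨h1, h2⟩ := add_ne_zero_of_notMem hirr hP
  have hQ0 : Q ≠ 0 := by
    rintro rfl
    exact h1 (by rw [← hz, mul_zero])
  have hdiff : ‖z - w‖ * ‖Q‖ = 2 * ‖s‖ := by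
    rw [← norm_mul, show (z - w) * Q = 2 * s by linear_combination hz - hw, norm_mul]
    simp
  have hQM : ‖Q‖ ≤ M := by
    calc ‖Q‖ ≤ (40 * ‖s‖ * ‖z - w‖) * ‖Q‖ := le_mul_of_one_le_left (norm_nonneg _) hsep
      _ = 40 * ‖s‖ * (‖z - w‖ * ‖Q‖) := by ring
      _ = M := by rw [hdiff, hM]; ring
  have hz1 : ‖z‖ ≤ 1 := (norm_le_abs_re_add_abs_im z).trans hr.1
  have hPM : ‖P‖ ≤ M + ‖s‖ := by
    rw [show P = z * Q - s by rw [hz]; ring]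
    refine (norm_sub_le _ _).trans ?_
    rw [norm_mul]
    nlinarith [norm_nonneg Q]
  refine ⟨(P, Q), ⟨⟨hP, hPM⟩, ⟨hQ, hQM⟩⟩, ?_⟩
  simp only [← hz, ← hw, mul_div_cancel_right₀ _ hQ0]

/-! ### Invariance and injectivity of the natural extension -/

/-- The natural extension of Tanaka's map. -/
noncomputable def tanakaExtension (x : ℂ × ℂ) : ℂ × ℂ :=
  (1 / x.1 - tanakaFloor (1 / x.1), 1 / x.2 - tanakaFloor (1 / x.1))

theorem gaussian_re_im (a b : ℤ) :
    ((a : ℂ) + (b : ℂ) * I).re = a ∧ ((a : ℂ) + (b : ℂ) * I).im = b := by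
  simp

theorem mapsTo_tanakaExtension {s : ℂ} (hirr : s ∉ GaussianField) :
    Set.MapsTo tanakaExtension (reducedSet s) (reducedSet s) := by
  rintro ⟨z, w⟩ ⟨hr, hn, hc⟩
  simp only at hr hn hc
  have hz0 := hc.ne_zero hirr
  have hw0 := hc.symm.ne_zero hirr
  obtain ⟨a, b, hev, hfl, hab⟩ := tanakaFloor_spec (1 / z)
  obtain ⟨h1, h2, h3⟩ := hr.inv hz0
  have hirr' : ∀ c d : ℤ, ¬ ((1 / z).re = c ∧ (1 / z).im = d) := by
    rintro c d ⟨hre, him⟩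
    apply hc.notMem hirr
    have : 1 / z = (c : ℂ) + (d : ℂ) * I := by
      obtain ⟨g1, g2⟩ := gaussian_re_im c d
      exact Complex.ext (hre.trans g1.symm) (him.trans g2.symm)
    rw [show z = (1 / z)⁻¹ by simp, this]
    exact inv_mem (gaussianSubring_le (mem_gaussianSubring_iff.2 ⟨c, d, rfl⟩))
  obtain ⟨s1, s2⟩ := reduced_step hirr' h1 h2 h3 hev hab
  obtain ⟨g1, g2⟩ := gaussian_re_im a b
  refine ⟨⟨?_, ?_, ?_⟩, ?_, ?_⟩
  · simpa only [tanakaExtension, hfl, sub_re, sub_im, g1, g2] using hab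
  · simpa only [tanakaExtension, hfl, sub_re, sub_im, g1, g2] using s1
  · simpa only [tanakaExtension, hfl, sub_re, sub_im, g1, g2] using s2
  · simp only [tanakaExtension, hfl]
    exact (hn.inv hz0 hw0).translate hev
  · simp only [tanakaExtension, hfl]
    exact hc.sub_mem hirr (mem_gaussianSubring_iff.2 ⟨a, b, rfl⟩)

theorem not_on_side {s z w : ℂ} (hirr : s ∉ GaussianField) (hc : IsConjugatePair s z w)
    (hn : NoCommonCircle z w) {p q : ℤ} (hp : p = 1 ∨ p = -1) (hq : q = 1 ∨ q = -1) :
    p * z.re + q * z.im ≠ 1 := by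
  intro h
  have h' := hc.on_line hirr (by rcases hp with rfl | rfl <;> norm_num) h
  refine hn 0 p q (-1) ?_ (by decide) ⟨?_, ?_⟩
  · rcases hp with rfl | rfl <;> rcases hq with rfl | rfl <;> norm_num
  · push_cast; linarith
  · push_cast; linarith

theorem even_sub_of_sq_add_sq_lt {c d : ℤ} {x y x' y' : ℝ} (h : x ^ 2 + y ^ 2 < 1)
    (h' : x' ^ 2 + y' ^ 2 < 1) (hc : x - x' = c) (hd : y - y' = d) (hev : Even (c + d)) :
    (c = 0 ∧ d = 0) ∨ ((c = 1 ∨ c = -1) ∧ (d = 1 ∨ d = -1)) := by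
  rcases int_sq_add_sq_of_even hev with h0 | h0 | h4
  · exact Or.inl h0
  · exact Or.inr h0
  · exfalso
    have h5 : (4 : ℝ) ≤ (c : ℝ) ^ 2 + (d : ℝ) ^ 2 := by exact_mod_cast h4
    rw [← hc, ← hd] at h5
    nlinarith [sq_nonneg (x + x'), sq_nonneg (y + y')]

theorem injOn_tanakaExtension {s : ℂ} (hirr : s ∉ GaussianField) :
    Set.InjOn tanakaExtension (reducedSet s) := by
  rintro ⟨z₁, w₁⟩ hx₁ ⟨z₂, w₂⟩ hx₂ heq
  have himg := mapsTo_tanakaExtension hirr hx₁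
  obtain ⟨hr₁, hn₁, hc₁⟩ := hx₁
  obtain ⟨hr₂, hn₂, hc₂⟩ := hx₂
  simp only at hr₁ hn₁ hc₁ hr₂ hn₂ hc₂
  obtain ⟨a₁, b₁, hev₁, hfl₁, hab₁⟩ := tanakaFloor_spec (1 / z₁)
  obtain ⟨a₂, b₂, hev₂, hfl₂, hab₂⟩ := tanakaFloor_spec (1 / z₂)
  obtain ⟨-, hη₁, hd₁⟩ := hr₁.inv (hc₁.ne_zero hirr)
  obtain ⟨-, hη₂, hd₂⟩ := hr₂.inv (hc₂.ne_zero hirr)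
  have hside := fun p q hp hq => not_on_side (p := p) (q := q) hirr himg.2.2 himg.2.1 hp hq
  simp only [tanakaExtension, hfl₁, hfl₂, Prod.mk.injEq] at heq hside
  obtain ⟨ez, ew⟩ := heq
  obtain ⟨g1, g2⟩ := gaussian_re_im a₁ b₁
  obtain ⟨g3, g4⟩ := gaussian_re_im a₂ b₂
  have ezr := congrArg re ez
  have ezi := congrArg im ez
  have ewr := congrArg re ew
  have ewi := congrArg im ew
  simp only [sub_re, sub_im, g1, g2, g3, g4] at ezr ezi ewr ewi hside
  have hev : Even ((a₁ - a₂) + (b₁ - b₂)) := by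
    obtain ⟨u, hu⟩ := hev₁
    obtain ⟨v, hv⟩ := hev₂
    exact ⟨u - v, by linarith⟩
  rcases even_sub_of_sq_add_sq_lt hη₁ hη₂ (c := a₁ - a₂) (d := b₁ - b₂)
    (by push_cast; linarith) (by push_cast; linarith) hev with ⟨ha, hb⟩ | ⟨ha, hb⟩
  · have ha' : a₁ = a₂ := by linarith
    have hb' : b₁ = b₂ := by linarith
    subst ha' hb'
    have e1 : z₁ = z₂ := by simpa using ez
    have e2 : w₁ = w₂ := by simpa using ew
    rw [e1, e2]
  -- The quotients differ by `e = p + qi`, so each of `1/w₁ - e` and `1/w₂ + e` lies in the unit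
  -- disc. Reducedness of both pairs then puts `1/z₁` exactly on the line of a side.
  · exfalso
    obtain ⟨p, hp⟩ : ∃ p, p = a₁ - a₂ := ⟨_, rfl⟩
    obtain ⟨q, hq⟩ : ∃ q, q = b₁ - b₂ := ⟨_, rfl⟩
    rw [← hp] at ha
    rw [← hq] at hb
    have hpr : (p : ℝ) = a₁ - a₂ := by rw [hp]; push_cast; ring
    have hqr : (q : ℝ) = b₁ - b₂ := by rw [hq]; push_cast; ring
    have pr : (p : ℝ) = 1 ∨ (p : ℝ) = -1 := by rcases ha with h | h <;> simp [h]
    have qr : (q : ℝ) = 1 ∨ (q : ℝ) = -1 := by rcases hb with h | h <;> simp [h]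
    have pr' : -(p : ℝ) = 1 ∨ -(p : ℝ) = -1 := by rcases pr with h | h <;> simp [h]
    have qr' : -(q : ℝ) = 1 ∨ -(q : ℝ) = -1 := by rcases qr with h | h <;> simp [h]
    have p2 : (p : ℝ) ^ 2 = 1 := by rcases pr with h | h <;> rw [h] <;> norm_num
    have q2 : (q : ℝ) ^ 2 = 1 := by rcases qr with h | h <;> rw [h] <;> norm_num
    have ex : (1 / z₁).re = (1 / z₂).re + p := by linarith
    have ey : (1 / z₁).im = (1 / z₂).im + q := by linarith
    have eh : (1 / w₁).re = (1 / w₂).re + p := by linarith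
    have ek : (1 / w₁).im = (1 / w₂).im + q := by linarith
    have le1 : p * (1 / z₁).re + q * (1 / z₁).im ≤ 1 := by
      by_contra hcon
      have := hd₁ p q pr qr (not_le.1 hcon)
      rw [eh, ek] at this
      simp only [add_sub_cancel_right] at this
      linarith
    have ge1 : 1 ≤ p * (1 / z₁).re + q * (1 / z₁).im := by
      by_contra hcon
      have := hd₂ (-p) (-q) pr' qr' (by rw [ex, ey] at hcon; nlinarith)
      rw [sub_neg_eq_add, sub_neg_eq_add, ← eh, ← ek] at this
      linarith
    have e1 := le_antisymm le1 ge1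
    have b1 := sign_mul_le hab₁ pr qr
    have b2 := sign_mul_le hab₁ pr' qr'
    -- Subtracting the floor changes the value 1 of this linear form by an even integer; the result
    -- is in `[-1, 1]`, hence `±1`, so the image is on a side.
    have hpar : Even (p * a₁ + q * b₁) := by
      obtain ⟨u, hu⟩ := hev₁
      rcases ha with h | h <;> rcases hb with h' | h' <;> rw [h, h']
      · exact ⟨u, by linarith⟩
      · exact ⟨u - b₁, by linarith⟩
      · exact ⟨u - a₁, by linarith⟩
      · exact ⟨-u, by linarith⟩
    obtain ⟨t, ht⟩ := hpar
    have htr : (p : ℝ) * a₁ + q * b₁ = t + t := by exact_mod_cast ht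
    have t1 : (0 : ℝ) ≤ t := by linarith
    have t2 : (t : ℝ) ≤ 1 := by linarith
    have t1' : 0 ≤ t := by exact_mod_cast t1
    have t2' : t ≤ 1 := by exact_mod_cast t2
    rcases (by omega : t = 0 ∨ t = 1) with rfl | rfl
    · apply hside p q ha hb
      push_cast at htr
      linarith
    · apply hside (-p) (-q) (by omega) (by omega)
      push_cast at htr ⊢
      linarith

/-! ### The initial pair -/

theorem initial_mem_reducedSet {s : ℂ} (hs2 : s ^ 2 ∈ gaussianSubring)
    (hbig : 1 < s.re ^ 2 + s.im ^ 2) :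
    (s - tanakaFloor s, -s - tanakaFloor s) ∈ reducedSet s := by
  obtain ⟨a, b, hev, hfl, hab⟩ := tanakaFloor_spec s
  obtain ⟨g1, g2⟩ := gaussian_re_im a b
  have haG : (a : ℂ) + (b : ℂ) * I ∈ gaussianSubring := mem_gaussianSubring_iff.2 ⟨a, b, rfl⟩
  rw [hfl]
  refine ⟨?_, (noCommonCircle_neg hbig.le).translate hev,
    ⟨-((a : ℂ) + (b : ℂ) * I), 1, s ^ 2 - ((a : ℂ) + (b : ℂ) * I) ^ 2, neg_mem haG, one_mem _,
      sub_mem hs2 (pow_mem haG 2), by ring, by ring, by ring⟩⟩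
  simp only [IsReducedPair, sub_re, sub_im, neg_re, neg_im, g1, g2]
  generalize s.re = x at *
  generalize s.im = y at *
  have hα : (x - a) ^ 2 + (y - b) ^ 2 ≤ 1 := by
    nlinarith [sq_abs (x - a), sq_abs (y - b), abs_nonneg (x - a), abs_nonneg (y - b),
      mul_nonneg (abs_nonneg (x - a)) (abs_nonneg (y - b))]
  have hne : ¬ (a = 0 ∧ b = 0) := by
    rintro ⟨rfl, rfl⟩
    simp only [Int.cast_zero, sub_zero] at hα
    linarith
  -- A point of the closed unit disc moved by more than 2 leaves that disc; 5 is the first integer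
  -- above 4.
  have far : ∀ c d : ℤ, 5 ≤ c ^ 2 + d ^ 2 → 1 < (x - a + c) ^ 2 + (y - b + d) ^ 2 := by
    intro c d hcd
    have h5 : (5 : ℝ) ≤ (c : ℝ) ^ 2 + (d : ℝ) ^ 2 := by exact_mod_cast hcd
    generalize x - a = X at *
    generalize y - b = Y at *
    by_contra hcon
    nlinarith [sq_nonneg (2 * X + c), sq_nonneg (2 * Y + d)]
  refine ⟨hab, ?_, ?_⟩
  · have h8 : 5 ≤ (2 * a) ^ 2 + (2 * b) ^ 2 := by
      rcases int_sq_add_sq_of_even hev with h0 | ⟨h1, h2⟩ | h4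
      · exact absurd h0 hne
      · rcases h1 with rfl | rfl <;> rcases h2 with rfl | rfl <;> norm_num
      · nlinarith
    have := far (2 * a) (2 * b) h8
    push_cast at this
    nlinarith
  · intro p q hp hq _
    obtain ⟨p', hp', rfl⟩ : ∃ p' : ℤ, (p' = 1 ∨ p' = -1) ∧ p = p' := by
      rcases hp with rfl | rfl
      · exact ⟨1, by simp, by simp⟩
      · exact ⟨-1, by simp, by simp⟩
    obtain ⟨q', hq', rfl⟩ : ∃ q' : ℤ, (q' = 1 ∨ q' = -1) ∧ q = q' := by
      rcases hq with rfl | rfl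
      · exact ⟨1, by simp, by simp⟩
      · exact ⟨-1, by simp, by simp⟩
    by_cases hab' : a = -p' ∧ b = -q'
    -- Here `w - e = -s`, so the bound is exactly `|s| > 1`; it fails on the unit circle.
    · obtain ⟨rfl, rfl⟩ := hab'
      push_cast
      nlinarith
    · have h5 : 5 ≤ (2 * a + p') ^ 2 + (2 * b + q') ^ 2 := by
        rcases int_sq_add_sq_of_even hev with h0 | ⟨h1, h2⟩ | h4
        · exact absurd h0 hne
        · rcases h1 with rfl | rfl <;> rcases h2 with rfl | rfl <;>
          rcases hp' with rfl | rfl <;> rcases hq' with rfl | rfl <;>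
          first
            | (norm_num; done)
            | exact absurd (by norm_num) hab'
        · by_contra hcon
          have h6 : (p' : ℤ) ^ 2 = 1 := by rcases hp' with rfl | rfl <;> norm_num
          have h7 : (q' : ℤ) ^ 2 = 1 := by rcases hq' with rfl | rfl <;> norm_num
          nlinarith [sq_nonneg (a + p'), sq_nonneg (b + q'), sq_nonneg (4 * a + 5 * p'),
            sq_nonneg (4 * b + 5 * q'), sq_nonneg (3 * a + 4 * p'), sq_nonneg (3 * b + 4 * q')]
      have := far (2 * a + p') (2 * b + q') h5
      push_cast at this
      nlinarith

/-! ### Pure periodicity from a permutation of a finite set -/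

theorem tanakaMap_of_ne {z : ℂ} (hz : z ≠ 0) : tanakaMap z = 1 / z - tanakaFloor (1 / z) := by
  simp [tanakaMap, hz]

theorem isPurelyPeriodic_of_periodic {α : ℂ} (h0 : ∀ k, tanakaOrbit α k ≠ 0) {p : ℕ}
    (hp : 1 ≤ p) (h : tanakaOrbit α p = α) : IsPurelyPeriodicTanaka α := by
  have key : ∀ k, tanakaOrbit α (k + p) = tanakaOrbit α k := by
    intro k
    simp only [tanakaOrbit] at h ⊢
    rw [Function.iterate_add_apply, h]
  exact ⟨h0, p, hp, fun k => ⟨key k, by rw [key k]⟩⟩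

theorem isPurelyPeriodic_of_mem_reducedSet {s : ℂ} (hirr : s ∉ GaussianField) {x : ℂ × ℂ}
    (hx : x ∈ reducedSet s) : IsPurelyPeriodicTanaka x.1 := by
  have hmaps := mapsTo_tanakaExtension hirr
  have hiter : ∀ k, tanakaExtension^[k] x ∈ reducedSet s := fun k => hmaps.iterate k hx
  have horb : ∀ k, tanakaOrbit x.1 k = (tanakaExtension^[k] x).1 := by
    intro k
    induction k with
    | zero => rfl
    | succ k ih =>
      rw [tanakaOrbit, Function.iterate_succ_apply', ← tanakaOrbit, ih,
        Function.iterate_succ_apply', tanakaMap_of_ne ((hiter k).2.2.ne_zero hirr)]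
      rfl
  have : Finite (reducedSet s) := finite_reducedSet hirr
  have hinj : Function.Injective (hmaps.restrict tanakaExtension _ _) :=
    (hmaps.restrict_inj).2 (injOn_tanakaExtension hirr)
  obtain ⟨p, hp, hper⟩ := hinj.mem_periodicPts (⟨x, hx⟩ : reducedSet s)
  have hper' : tanakaExtension^[p] x = x := by
    have h := congrArg Subtype.val hper.eq
    rwa [hmaps.iterate_restrict] at h
  refine isPurelyPeriodic_of_periodic (fun k => ?_) hp (by rw [horb, hper'])
  rw [horb]
  exact (hiter k).2.2.ne_zero hirr

/-! ### Square roots on the unit circle -/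

theorem tanakaFloor_diagonal {r : ℝ} {n : ℤ} (h1 : n - 1 / 2 < r) (h2 : r < n + 1 / 2)
    {σ τ : ℝ} (hσ : σ = 1 ∨ σ = -1) (hτ : τ = 1 ∨ τ = -1) :
    tanakaFloor (r * (σ + τ * I)) = n * (σ + τ * I) := by
  have pos : ⌊r + 1 / 2⌋ = n := by
    rw [Int.floor_eq_iff]
    constructor <;> linarith
  have neg : ⌊-r + 1 / 2⌋ = -n := by
    rw [Int.floor_eq_iff]
    push_cast
    constructor <;> linarith
  have zero : ⌊(0 : ℝ) + 1 / 2⌋ = 0 := by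
    rw [Int.floor_eq_iff]
    norm_num
  have hu : coordU (r * (σ + τ * I)) = r * ((σ + τ) / 2) := by
    simp [coordU]; ring
  have hv : coordV (r * (σ + τ * I)) = r * ((σ - τ) / 2) := by
    simp [coordV]; ring
  rw [tanakaFloor, hu, hv]
  rcases hσ with rfl | rfl <;> rcases hτ with rfl | rfl
  · rw [show r * ((1 + 1) / 2) = r by ring, show r * ((1 - 1) / 2) = 0 by ring, pos, zero]
    push_cast; ring
  · rw [show r * ((1 + -1) / 2) = 0 by ring, show r * ((1 - -1) / 2) = r by ring, pos, zero]
    push_cast; ring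
  · rw [show r * ((-1 + 1) / 2) = 0 by ring, show r * ((-1 - 1) / 2) = -r by ring, neg, zero]
    push_cast; ring
  · rw [show r * ((-1 + -1) / 2) = -r by ring, show r * ((-1 - -1) / 2) = 0 by ring, neg, zero]
    push_cast; ring

theorem diagonal_ne_zero {t σ τ : ℝ} (ht : 0 < t) (hσ : σ = 1 ∨ σ = -1) :
    (t : ℂ) * (σ + τ * I) ≠ 0 := by
  intro h
  have h' := congrArg re h
  simp only [mul_re, ofReal_re, add_re, I_re, mul_zero, ofReal_im, I_im, mul_one, sub_self,
    add_zero, add_im, mul_im, zero_add, zero_mul, sub_zero, zero_re] at h'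
  rcases hσ with rfl | rfl <;> linarith

/-- Since `2(1 - r)(1 + r) = 1`, the inverse is `(1 + r)(σ - τi)`, and `1 + r` rounds to 2. -/
theorem tanakaMap_diagonal {r : ℝ} (h0 : 0 < r) (hr : 2 * r ^ 2 = 1) {σ τ : ℝ}
    (hσ : σ = 1 ∨ σ = -1) (hτ : τ = 1 ∨ τ = -1) :
    tanakaMap ((1 - r : ℝ) * (σ + τ * I)) = (1 - r : ℝ) * ((-σ : ℝ) + τ * I) := by
  have hr1 : r < 1 := by nlinarith
  have hr2 : 1 / 2 < r := by nlinarith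
  have hne := diagonal_ne_zero (τ := τ) (sub_pos.2 hr1) hσ
  have hτ' : -τ = 1 ∨ -τ = -1 := by rcases hτ with rfl | rfl <;> simp
  have hrc : 2 * (r : ℂ) ^ 2 = 1 := by exact_mod_cast hr
  have s2 : (σ : ℂ) ^ 2 = 1 := by rcases hσ with rfl | rfl <;> norm_num
  have t2 : (τ : ℂ) ^ 2 = 1 := by rcases hτ with rfl | rfl <;> norm_num
  have hinv : 1 / (((1 - r : ℝ) : ℂ) * (σ + τ * I)) = ((1 + r : ℝ) : ℂ) * (σ + (-τ : ℝ) * I) := by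
    rw [div_eq_iff hne]
    push_cast
    linear_combination hrc - (1 - (r : ℂ) ^ 2) * (s2 + t2 - τ ^ 2 * I_sq)
  rw [tanakaMap_of_ne hne, hinv,
    tanakaFloor_diagonal (n := 2) (by push_cast; linarith) (by push_cast; linarith) hσ hτ']
  push_cast
  ring

theorem isPurelyPeriodic_diagonal {r : ℝ} (h0 : 0 < r) (hr : 2 * r ^ 2 = 1) {σ τ : ℝ}
    (hσ : σ = 1 ∨ σ = -1) (hτ : τ = 1 ∨ τ = -1) :
    IsPurelyPeriodicTanaka ((1 - r : ℝ) * (σ + τ * I)) := by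
  have hr1 : r < 1 := by nlinarith
  have hneg : ∀ {x : ℝ}, (x = 1 ∨ x = -1) → (-x = 1 ∨ -x = -1) := by
    rintro x (rfl | rfl) <;> simp
  refine isPurelyPeriodic_of_periodic (p := 2) ?_ (by norm_num) ?_
  · intro k
    have : ∃ σ' : ℝ, (σ' = 1 ∨ σ' = -1) ∧
        tanakaOrbit ((1 - r : ℝ) * (σ + τ * I)) k = (1 - r : ℝ) * (σ' + τ * I) := by
      induction k with
      | zero => exact ⟨σ, hσ, rfl⟩
      | succ k ih =>
        obtain ⟨σ', hσ', he⟩ := ih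
        refine ⟨-σ', hneg hσ', ?_⟩
        rw [tanakaOrbit, Function.iterate_succ_apply', ← tanakaOrbit, he,
          tanakaMap_diagonal h0 hr hσ' hτ]
    obtain ⟨σ', hσ', he⟩ := this
    rw [he]
    exact diagonal_ne_zero (sub_pos.2 hr1) hσ'
  · change tanakaMap (tanakaMap _) = _
    rw [tanakaMap_diagonal h0 hr hσ hτ, tanakaMap_diagonal h0 hr (hneg hσ) hτ, neg_neg]

/-- The square roots of Gaussian integers in the closed unit disc outside `ℚ(i)` lie on the
diagonals. -/
theorem diagonal_of_small {m n : ℤ} {s : ℂ} (hs : s ^ 2 = (m : ℂ) + (n : ℂ) * I)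
    (hirr : s ∉ GaussianField) (hsmall : s.re ^ 2 + s.im ^ 2 ≤ 1) :
    ∃ r σ τ : ℝ, 0 < r ∧ 2 * r ^ 2 = 1 ∧ (σ = 1 ∨ σ = -1) ∧ (τ = 1 ∨ τ = -1) ∧
      s = r * (σ + τ * I) := by
  obtain ⟨g1, g2⟩ := gaussian_re_im m n
  have hre := congrArg re hs
  have him := congrArg im hs
  rw [g1, sq, mul_re] at hre
  rw [g2, sq, mul_im] at him
  -- Thus `s²` is `0`, `±1` or `±i`, and all but `±i` are squares in `ℚ(i)`.
  have hmn : ((m : ℝ)) ^ 2 + (n : ℝ) ^ 2 ≤ 1 := by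
    have e : ((m : ℝ)) ^ 2 + (n : ℝ) ^ 2 = (s.re ^ 2 + s.im ^ 2) ^ 2 := by
      rw [← hre, ← him]; ring
    rw [e]
    nlinarith [sq_nonneg s.re, sq_nonneg s.im]
  have hmn' : m ^ 2 + n ^ 2 ≤ 1 := by exact_mod_cast hmn
  have root : ∀ c : ℂ, c ∈ GaussianField → s ^ 2 ≠ c ^ 2 := by
    intro c hc h
    rcases sq_eq_sq_iff_eq_or_eq_neg.1 h with h | h
    · exact hirr (h ▸ hc)
    · exact hirr (h ▸ neg_mem hc)
  have hm1 : -1 ≤ m ∧ m ≤ 1 := ⟨by nlinarith [sq_nonneg n], by nlinarith [sq_nonneg n]⟩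
  have hn1 : -1 ≤ n ∧ n ≤ 1 := ⟨by nlinarith [sq_nonneg m], by nlinarith [sq_nonneg m]⟩
  have hn0 : n ≠ 0 := by
    rintro rfl
    obtain ⟨h1, h2⟩ := hm1
    rcases (by omega : m = -1 ∨ m = 0 ∨ m = 1) with rfl | rfl | rfl
    · exact root I I_mem_gaussianField (by rw [hs]; simp)
    · exact root 0 (zero_mem _) (by rw [hs]; simp)
    · exact root 1 (one_mem _) (by rw [hs]; simp)
  have hm0 : m = 0 := by
    have : 1 ≤ n ^ 2 := by have := sq_pos_of_ne_zero hn0; omega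
    have : m ^ 2 ≤ 0 := by linarith
    exact pow_eq_zero_iff (two_ne_zero) |>.1 (le_antisymm this (sq_nonneg m))
  subst hm0
  rw [Int.cast_zero] at hre
  have hn2 : (n : ℝ) ^ 2 = 1 := by
    have : n ^ 2 = 1 := by
      rcases (by omega : n = -1 ∨ n = 1) with rfl | rfl <;> norm_num
    exact_mod_cast this
  have hxy : s.im ^ 2 = s.re ^ 2 := by linarith
  have h2 : 2 * s.re ^ 2 = 1 := by
    have h4 : (2 * s.re ^ 2) ^ 2 = 1 := by
      rw [← him] at hn2
      linear_combination hn2 - 4 * s.re ^ 2 * hxy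
    nlinarith [sq_nonneg s.re]
  have hx0 : s.re ≠ 0 := by
    intro h
    rw [h] at h2
    norm_num at h2
  have signs : ∀ y : ℝ, y ^ 2 = s.re ^ 2 → ∃ σ : ℝ, (σ = 1 ∨ σ = -1) ∧ y = |s.re| * σ := by
    intro y hy
    rw [← sq_abs s.re] at hy
    rcases sq_eq_sq_iff_eq_or_eq_neg.1 hy with h | h
    · exact ⟨1, by simp, by rw [h]; ring⟩
    · exact ⟨-1, by simp, by rw [h]; ring⟩
  obtain ⟨σ, hσ, hx⟩ := signs s.re rfl
  obtain ⟨τ, hτ, hy⟩ := signs s.im hxy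
  refine ⟨|s.re|, σ, τ, abs_pos.2 hx0, by rw [sq_abs, h2], hσ, hτ, ?_⟩
  apply Complex.ext
  · simpa using hx
  · simpa using hy

theorem theorem6p5 (m n : ℤ) (s : ℂ) (hs : s ^ 2 = (m : ℂ) + (n : ℂ) * Complex.I)
    (hirr : s ∉ GaussianField) :
    IsPurelyPeriodicTanaka (s - tanakaFloor s) := by
  by_cases hbig : 1 < s.re ^ 2 + s.im ^ 2
  · exact isPurelyPeriodic_of_mem_reducedSet hirr
      (initial_mem_reducedSet (mem_gaussianSubring_iff.2 ⟨m, n, hs⟩) hbig)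
  · obtain ⟨r, σ, τ, h0, hr, hσ, hτ, rfl⟩ := diagonal_of_small hs hirr (not_lt.1 hbig)
    have hr1 : r < 1 := by nlinarith
    have hr2 : 1 / 2 < r := by nlinarith
    have hσ' : -σ = 1 ∨ -σ = -1 := by rcases hσ with rfl | rfl <;> simp
    have hτ' : -τ = 1 ∨ -τ = -1 := by rcases hτ with rfl | rfl <;> simp
    rw [tanakaFloor_diagonal (n := 1) (by push_cast; linarith) (by push_cast; linarith) hσ hτ]
    have h := isPurelyPeriodic_diagonal h0 hr hσ' hτ'
    have e : ((1 - r : ℝ) : ℂ) * ((-σ : ℝ) + (-τ : ℝ) * I) =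
        r * (σ + τ * I) - (1 : ℤ) * (σ + τ * I) := by
      push_cast
      ring
    rwa [e] at h
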